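/- Let $n\ge 2$. A function $f:\mathbb F_2^{n-1}\to\mathbb F_2$ generates the binary sequences $(s_t)_{t\ge0}$ that satisfy $s_{t+n}=s_t+f(s_{t+1},\dots,s_{t+n-1})$ for all $t\ge 0$. A de Bruijn sequence of order $n$ is a (cyclic) binary sequence of length $2^n$ in which every binary $n$-tuple appears exactly once. For $f:\mathbb F_2^{n-1}\to\mathbb F_2$ let $N(f;k)$ be the number of functions $g:\mathbb F_2^{n-1}\to\mathbb F_2$ that generate a de Bruijn sequence of order $n$ and disagree with $f$ at exactly $k$ points of $\mathbb F_2^{n-1}$, and let $G(f;y)=\sum_k N(f;k)y^k$. Let $l:\mathbb F_2^{n-1}\to\mathbb F_2$ be a linear function that generates an $m$-sequence, that is, a sequence of least period $2^n-1$ without a run of $n$ zeros. Then $$G(l;y)=\frac1{2^n}\left((1+y)^{2^{n-1}}-(1-y)^{2^{n-1}}\right),\qquad N(l;k)=\frac1{k!}\,G^{(k)}(l;0)\quad(k\ge0),$$ and: 1. $N(l;1)=1$. 2. $N(l;k)=0$ for every even $k\ge 0$; in particular $N(l;2)=0$. 3. $N(l;3)=\dfrac{(2^{n-1}-1)(2^{n-1}-2)}{3!}$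 (the Helleseth–Kløve formula). 4. $N(l;5)=\dfrac{(2^{n-1}-1)(2^{n-1}-2)(2^{n-1}-3)(2^{n-1}-4)}{5!}$. 5. $N(l;k)=\dfrac{(2^{n-1}-1)(2^{n-1}-2)\cdots(2^{n-1}-k+1)}{k!}$ for every odd $k\le 2^{n-1}-1$ (for $k=1$ the product is empty). 6. $N(l;2^{n-1}-1)=1$. 7. $N(l;k)=0$ for every $k>2^{n-1}-1$. 8. $G(l;1)=\displaystyle\sum_{k=1}^{2^{n-1}-1}N(l;k)=2^{2^{n-1}-n}$. -/

import Mathlib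

/-- The binary sequence `s` is generated by the nonsingular feedback function
`x₀ + f(x₁, …, x_{n-1})` of order `n`:
`s_{t+n} = s_t + f(s_{t+1}, …, s_{t+n-1})` for all `t`. -/
def Generates (n : ℕ) (f : (Fin (n - 1) → ZMod 2) → ZMod 2) (s : ℕ → ZMod 2) : Prop :=
  ∀ t : ℕ, s (t + n) = s t + f (fun i => s (t + 1 + i))

/-- The periodic extension of a (cyclic) de Bruijn sequence of order `n`: the sequence repeats
after `2 ^ n` terms, and among the `2 ^ n` windows of length `n` that start in one such stretch
every binary `n`-tuple occurs exactly once. -/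
def IsDeBruijnSequence (n : ℕ) (s : ℕ → ZMod 2) : Prop :=
  Function.Periodic s (2 ^ n) ∧
    ∀ w : Fin n → ZMod 2, ∃! t : ℕ, t < 2 ^ n ∧ ∀ i : Fin n, s (t + i) = w i

/-- The set `S(n)` of functions of `n - 1` variables that generate a de Bruijn sequence
of order `n`. -/
def deBruijnFunctions (n : ℕ) : Set ((Fin (n - 1) → ZMod 2) → ZMod 2) :=
  {g | ∃ s : ℕ → ZMod 2, IsDeBruijnSequence n s ∧ Generates n g s}

/-- The set `S(f; k)` of all `g ∈ S(n)` for which the truth table of `f + g` has weight `k`,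
that is, `f` and `g` disagree in exactly `k` places. -/
def deBruijnAtDistance (n : ℕ) (f : (Fin (n - 1) → ZMod 2) → ZMod 2) (k : ℕ) :
    Set ((Fin (n - 1) → ZMod 2) → ZMod 2) :=
  {g | g ∈ deBruijnFunctions n ∧ hammingNorm (f + g) = k}

/-- `N(f; k)`, the number of elements of `S(f; k)`. -/
noncomputable def deBruijnCount (n : ℕ) (f : (Fin (n - 1) → ZMod 2) → ZMod 2) (k : ℕ) : ℕ :=
  (deBruijnAtDistance n f k).ncard

/-- `G(f; y) = ∑ₖ N(f; k) yᵏ`. A truth table has `2 ^ (n - 1)` places, so the terms with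
`k > 2 ^ (n - 1)` all vanish. -/
noncomputable def deBruijnGenFun (n : ℕ) (f : (Fin (n - 1) → ZMod 2) → ZMod 2) (y : ℝ) : ℝ :=
  ∑ k ∈ Finset.range (2 ^ (n - 1) + 1), (deBruijnCount n f k : ℝ) * y ^ k

/-- The function `l` generates a sequence of least period `2 ^ n - 1` without a run of
`n` zeros; for linear `l` this is an `m`-sequence of order `n`. -/
def GeneratesMSequence (n : ℕ) (l : (Fin (n - 1) → ZMod 2) → ZMod 2) : Prop :=
  ∃ s : ℕ → ZMod 2, Generates n l s ∧
    IsLeast {p : ℕ | 0 < p ∧ Function.Periodic s p} (2 ^ n - 1) ∧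
    ¬ ∃ t : ℕ, ∀ i < n, s (t + i) = 0

/-! Write `n = m + 1`, let `P_g` be the permutation matrix of the state map of `g`, and let `J` be
the all-ones matrix on the `2 ^ n` states. The function `g` generates a de Bruijn sequence exactly
when its state map is a single cycle, and `det (I - P_g + J)` detects this: it is `(2 ^ n) ^ 2` for
a single cycle and `0` otherwise. Hence `(2 ^ n) ^ 2 * G(f; y)` is the sum of `y ^ hammingNorm (f +
g) * det (I - P_g + J)` over all `g`.

That sum is a single determinant. The value `g d` only decides which of the states `(0, d)`, `(1,
d)` receives which of two fixed successors, so the sum of their two rows does not depend on `g`.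
Adding one row to the other leaves a multilinear function of one row per `d` (`sum_det_sumElim`),
and `sum_det_stateShift` gives `(1 + y) ^ 2 ^ m * (2 ^ n) ^ 2 * G(f; y) = det K` with `K = (1 + y)
(I + J) - P_f - y P_{f + 1}`.

For linear `f = l`, pass to the basis of characters of `ZMod 2 ^ n`. There `P_l` permutes the
characters by the dual linear map, `P_{l + 1}` does the same up to signs, and `J` sees only the
trivial character. The `m`-sequence hypothesis makes the dual map one cycle on the nonzero vectors,
so `K` becomes a diagonal plus a weighted cycle, whose determinant has two terms: `2 ^ n * ((1 + y)
^ 2 ^ n - (1 - y ^ 2) ^ 2 ^ m)`. Cancelling `(1 + y) ^ 2 ^ m` gives the closed form, and its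
binomial coefficients give all the counts. -/

/-! ### Determinants that detect full cycles -/

/-- A matrix supported on the diagonal and on the graph of a cycle has only two nonzero
terms in its Leibniz expansion. -/
theorem Matrix.det_diagonal_sub_cycle {ι R : Type*} [Fintype ι] [DecidableEq ι] [CommRing R]
    (σ : Equiv.Perm ι) (hσ : σ.IsCycle) (d w : ι → R) :
    (Matrix.of fun i j => if i = j then d j else if i = σ j then -w j else 0).det =
      ∏ i, d i - (∏ i ∈ σ.support, w i) * ∏ i ∈ σ.supportᶜ, d i := by
  rw [Matrix.det_apply, Fintype.sum_eq_add 1 σ hσ.ne_one.symm]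
  · have h1 : ∏ i, Matrix.of (fun i j => if i = j then d j else if i = σ j then -w j else 0)
        (σ i) i = (∏ i ∈ σ.support, -w i) * ∏ i ∈ σ.supportᶜ, d i := by
      rw [← Finset.prod_mul_prod_compl σ.support]
      congr 1
      · refine Finset.prod_congr rfl fun i hi => ?_
        simp [Equiv.Perm.mem_support.1 hi]
      · refine Finset.prod_congr rfl fun i hi => ?_
        simp [Equiv.Perm.notMem_support.1 (Finset.mem_compl.1 hi)]
    rw [h1, hσ.sign, Finset.prod_neg]
    simp only [Matrix.of_apply, Equiv.Perm.sign_one, one_smul, Equiv.Perm.one_apply, if_true,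
      Units.smul_def, zsmul_eq_mul]
    push_cast
    -- The sign of the cycle is `-(-1) ^ σ.support.card` and the entries `-w` contribute `(-1) ^
    -- σ.support.card`; together they leave a single minus sign.
    have h2 : ((-1 : R) ^ σ.support.card) * (-1) ^ σ.support.card = 1 := by
      rw [← mul_pow]; simp
    linear_combination (-(∏ i ∈ σ.support, w i) * ∏ i ∈ σ.supportᶜ, d i) * h2
  · rintro τ ⟨hτ1, hτσ⟩
    by_contra hne
    have key : ∀ i, τ i = i ∨ τ i = σ i := by
      intro i
      by_contra! hi
      apply hne
      rw [Finset.prod_eq_zero (Finset.mem_univ i), smul_zero]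
      simp [hi.1, hi.2]
    obtain ⟨i, hi⟩ : ∃ i, τ i ≠ i := by
      by_contra! h
      exact hτ1 (Equiv.ext h)
    have hσi : σ i ≠ i := by
      rcases key i with h | h
      · exact absurd h hi
      · rwa [← h]
    -- Once `τ` follows `σ` at one point it must follow it along the whole cycle: fixing the next
    -- point would give that point two preimages under `τ`.
    have hpow : ∀ k : ℕ, τ ((σ ^ k) i) = σ ((σ ^ k) i) := by
      intro k
      induction k with
      | zero => exact (key i).resolve_left hi
      | succ k ih =>
        refine (key _).resolve_left fun h => hσi ?_
        rw [pow_succ', Equiv.Perm.mul_apply, ← ih] at h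
        have h := τ.injective h
        rw [ih, ← Equiv.Perm.mul_apply, ← pow_succ', pow_succ, Equiv.Perm.mul_apply] at h
        exact (σ ^ k).injective h
    refine hτσ (Equiv.ext fun j => ?_)
    by_cases hj : σ j = j
    · rcases key j with h | h
      · rw [h, hj]
      · exact h
    · obtain ⟨k, rfl⟩ := hσ.exists_pow_eq hσi hj
      exact hpow k

/-- The all-ones matrix has rank one, so the matrix determinant lemma applies. The extra factor `z`
avoids the exponent `Fintype.card ι - 1`. -/
theorem Matrix.det_smul_one_add_ones {ι : Type*} [Fintype ι] [DecidableEq ι] (z : ℝ)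
    (hz : z ≠ 0) :
    (z • (1 : Matrix ι ι ℝ) + Matrix.of fun _ _ => 1).det * z =
      z ^ Fintype.card ι * (z + Fintype.card ι) := by
  have h : z • (1 : Matrix ι ι ℝ) + (Matrix.of fun _ _ => 1) =
      z • (1 + Matrix.replicateCol Unit (fun _ : ι => z⁻¹) *
        Matrix.replicateRow Unit (fun _ : ι => (1 : ℝ))) := by
    ext i j
    simp [Matrix.mul_apply, mul_add, hz]
  rw [h, Matrix.det_smul, Matrix.det_one_add_replicateCol_mul_replicateRow]
  simp only [dotProduct, one_mul, Finset.sum_const, Finset.card_univ, nsmul_eq_mul]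
  field_simp

/-- The matrix `I - P` is singular, so it is perturbed to `X z`, with `z` added on the diagonal. All
row sums of `X z` equal `z`, whence `X z * (z • 1 + J) = z • (X z + J)`. Both determinants on the
left are known; the value at `z = 0` follows by continuity. -/
theorem det_one_sub_cycle_add_ones {ι : Type*} [Fintype ι] [DecidableEq ι]
    (σ : Equiv.Perm ι) (hσ : σ.IsCycle) (hs : σ.support = Finset.univ) :
    (Matrix.of fun i j => (if i = j then 1 else 0) - (if σ i = j then 1 else 0) + 1 :
      Matrix ι ι ℝ).det = (Fintype.card ι : ℝ) ^ 2 := by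
  have hne : ∀ i, σ i ≠ i := fun i => Equiv.Perm.mem_support.1 (hs ▸ Finset.mem_univ i)
  let X : ℝ → Matrix ι ι ℝ := fun z =>
    Matrix.of fun i j => if i = j then 1 + z else if i = σ j then -1 else 0
  let J : Matrix ι ι ℝ := Matrix.of fun _ _ => 1
  have hX : ∀ z, X z * J = z • J := by
    intro z
    ext i j
    have : ∀ k, X z i k = (if i = k then 1 + z else 0) - (if σ⁻¹ i = k then 1 else 0) := by
      intro k
      have h2 : (i = σ k) ↔ (σ⁻¹ i = k) := by rw [Equiv.Perm.inv_eq_iff_eq]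
      simp only [X, Matrix.of_apply]
      by_cases hk : i = k
      · have : ¬ σ⁻¹ i = k := by
          rw [← h2, hk]; exact (hne k).symm
        simp [hk] at this ⊢
        simp [this]
      · simp [hk, h2]
        split_ifs <;> simp
    simp [Matrix.mul_apply, J, this, Finset.sum_sub_distrib]
  have hdetX : ∀ z, (X z).det = (1 + z) ^ Fintype.card ι - 1 := by
    intro z
    have := Matrix.det_diagonal_sub_cycle σ hσ (fun _ => 1 + z) (fun _ => (1 : ℝ))
    rw [hs] at this
    simpa [X] using this
  have hgeom : ∀ z : ℝ, z * ∑ i ∈ Finset.range (Fintype.card ι), (1 + z) ^ i =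
      (1 + z) ^ Fintype.card ι - 1 := by
    intro z
    rw [← mul_geom_sum]; ring
  have hmain : ∀ z : ℝ, z ≠ 0 → (X z + J).det =
      (∑ i ∈ Finset.range (Fintype.card ι), (1 + z) ^ i) * (z + Fintype.card ι) := by
    intro z hz
    have h1 : X z * (z • 1 + J) = z • (X z + J) := by
      rw [mul_add, hX, smul_add]; simp
    have h2 := congrArg Matrix.det h1
    rw [Matrix.det_mul, Matrix.det_smul, hdetX, ← hgeom] at h2
    have h3 := Matrix.det_smul_one_add_ones (ι := ι) z hz
    have hzp : z ^ Fintype.card ι ≠ 0 := pow_ne_zero _ hz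
    apply mul_left_cancel₀ hzp
    rw [← h2]
    linear_combination (∑ i ∈ Finset.range (Fintype.card ι), (1 + z) ^ i) * h3
  have hcont : Continuous fun z => (X z + J).det := by
    refine Continuous.matrix_det (Continuous.add ?_ continuous_const)
    refine continuous_matrix fun i j => ?_
    simp only [X, Matrix.of_apply]
    split_ifs <;> fun_prop
  have hall := Continuous.ext_on (dense_compl_singleton (0 : ℝ)) hcont
    (by fun_prop : Continuous fun z : ℝ =>
      (∑ i ∈ Finset.range (Fintype.card ι), (1 + z) ^ i) * (z + Fintype.card ι))
    (fun z hz => hmain z hz)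
  have h0 := congrFun hall 0
  simp only [add_zero, one_pow, Finset.sum_const, Finset.card_range, nsmul_eq_mul, mul_one,
    zero_add] at h0
  -- `X` carries the cycle at the entries `i = σ j`, the statement at `σ i = j`.
  rw [sq, ← h0, ← Matrix.det_transpose]
  congr 1
  ext i j
  simp only [X, J, Matrix.transpose_apply, Matrix.of_apply, Matrix.add_apply]
  by_cases h : i = j
  · simp [h, hne]
  · by_cases h' : i = σ j
    · simp [h', hne, (hne j).symm]
    · simp [h, h', Ne.symm h, Ne.symm h']

theorem det_one_sub_perm_add_ones_eq_zero {ι : Type*} [Fintype ι] [DecidableEq ι]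
    (σ : Equiv.Perm ι) (S : Finset ι) (hS : S.Nonempty) (hS' : Sᶜ.Nonempty)
    (hinv : ∀ i, σ i ∈ S ↔ i ∈ S) :
    (Matrix.of fun i j => (if i = j then 1 else 0) - (if σ i = j then 1 else 0) + 1 :
      Matrix ι ι ℝ).det = 0 := by
  rw [← Matrix.exists_mulVec_eq_zero_iff]
  -- A kernel vector: it is constant on the invariant set and on its complement, so `I - P` kills
  -- it, and the two values are balanced to have total sum zero, so `J` kills it.
  refine ⟨fun i => if i ∈ S then (Sᶜ.card : ℝ) else -S.card, fun h => ?_, ?_⟩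
  · obtain ⟨i, hi⟩ := hS
    have := congrFun h i
    simp only [hi, if_true, Pi.zero_apply, Nat.cast_eq_zero] at this
    exact hS'.card_pos.ne' this
  · have hsum : ∑ i, (if i ∈ S then (Sᶜ.card : ℝ) else -S.card) = 0 := by
      rw [← Finset.sum_add_sum_compl S, Finset.sum_congr rfl fun i hi => if_pos hi,
        Finset.sum_congr rfl fun i hi => if_neg (Finset.mem_compl.1 hi)]
      simp only [Finset.sum_const, nsmul_eq_mul]
      ring
    ext i
    simp only [Matrix.mulVec, dotProduct, Matrix.of_apply, add_mul, sub_mul, ite_mul, one_mul,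
      zero_mul, Finset.sum_add_distrib, Finset.sum_sub_distrib, Finset.sum_ite_eq,
      Finset.mem_univ, if_true, hinv, hsum, Pi.zero_apply]
    ring

/-! ### Collapsing a sum of determinants by multilinearity -/

/-- Expanding a determinant over the choices, for each `d`, between two pairs of rows that have
the same sum. -/
theorem sum_det_sumElim {U R : Type*} [Fintype U] [DecidableEq U] [CommRing R]
    (p q : U → ZMod 2 → (U ⊕ U → R)) (S : U → (U ⊕ U → R))
    (hS : ∀ d e, p d e + q d e = S d) (y : R) :
    (1 + y) ^ Fintype.card U * ∑ e : U → ZMod 2, (∏ d, if e d = 0 then 1 else y) *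
        (Matrix.of (Sum.elim (fun d => p d (e d)) fun d => q d (e d))).det =
      (Matrix.of (Sum.elim (fun d => p d 0 + y • p d 1) fun d => q d 0 + y • q d 1)).det := by
  -- Adding the upper rows to the lower ones is multiplication by a unitriangular block matrix. With
  -- the lower rows then fixed, `currySum` views the determinant as multilinear in the upper rows
  -- alone.
  have hadd : ∀ a b : U → (U ⊕ U → R), (Matrix.of (Sum.elim a b)).det =
      (Matrix.detRowAlternating (R := R) (n := U ⊕ U)).toMultilinearMap.currySum a
        (fun d => a d + b d) := by
    intro a b
    have h : Matrix.of (Sum.elim a (fun d => a d + b d)) =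
        Matrix.fromBlocks 1 0 1 1 * Matrix.of (Sum.elim a b) := by
      ext i j
      rcases i with i | i <;>
        simp [Matrix.mul_apply, Matrix.one_apply]
    have h2 := congrArg Matrix.det h
    rw [Matrix.det_mul, Matrix.det_fromBlocks_zero₁₂] at h2
    simp only [Matrix.det_one, one_mul] at h2
    rw [← h2]
    rfl
  simp_rw [hadd, hS]
  -- On the right-hand side the lower rows become `(1 + y) • S d`, which is the source of the power
  -- of `1 + y`.
  have h1 : (fun d => p d 0 + y • p d 1 + (q d 0 + y • q d 1)) =
      fun d => (fun _ => 1 + y : U → R) d • S d := by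
    ext1 d
    rw [add_smul, one_smul]
    nth_rw 1 [← hS d 0]
    rw [← hS d 1, smul_add]
    abel
  have h2 : (fun d => p d 0 + y • p d 1) =
      fun d => ∑ e : ZMod 2, (if e = 0 then 1 else y) • p d e := by
    ext1 d
    have : (Finset.univ : Finset (ZMod 2)) = {0, 1} := rfl
    rw [this, Finset.sum_pair (by decide)]
    simp
  rw [h1, MultilinearMap.map_smul_univ, h2, MultilinearMap.map_sum]
  simp only [Finset.prod_const, Finset.card_univ, smul_eq_mul]
  congr 1
  rw [sum_apply]
  refine Finset.sum_congr rfl fun e _ => ?_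
  rw [MultilinearMap.map_smul_univ, smul_apply, smul_eq_mul]

/-! ### The state permutation of a shift register -/

/-- The permutation `(x₀, …, x_m) ↦ (x₁, …, x_m, x₀ + g (x₁, …, x_m))` of the states of the
feedback shift register given by `g`. -/
def stateShift {m : ℕ} (g : (Fin m → ZMod 2) → ZMod 2) :
    Equiv.Perm (Fin (m + 1) → ZMod 2) where
  toFun x := Fin.snoc (α := fun _ => ZMod 2) (Fin.tail x) (x 0 + g (Fin.tail x))
  invFun y := Fin.cons (α := fun _ => ZMod 2)
    (y (Fin.last m) + g (Fin.init (α := fun _ => ZMod 2) y))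
    (Fin.init (α := fun _ => ZMod 2) y)
  left_inv x := by
    simp [add_assoc, CharTwo.add_self_eq_zero, Fin.cons_self_tail]
  right_inv y := by
    simp [add_assoc, CharTwo.add_self_eq_zero, Fin.snoc_init_self]

theorem stateShift_apply {m : ℕ} (g : (Fin m → ZMod 2) → ZMod 2) (x : Fin (m + 1) → ZMod 2) :
    stateShift g x = Fin.snoc (α := fun _ => ZMod 2) (Fin.tail x) (x 0 + g (Fin.tail x)) := rfl

theorem stateShift_castSucc {m : ℕ} (g : (Fin m → ZMod 2) → ZMod 2)
    (x : Fin (m + 1) → ZMod 2) (i : Fin m) : stateShift g x i.castSucc = x i.succ := by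
  simp [stateShift_apply, Fin.tail]

theorem stateShift_last {m : ℕ} (g : (Fin m → ZMod 2) → ZMod 2) (x : Fin (m + 1) → ZMod 2) :
    stateShift g x (Fin.last m) = x 0 + g (Fin.tail x) := by
  simp [stateShift_apply]

/-- The length-`k` window of a sequence that starts at `t`. -/
def seqWindow (k : ℕ) (s : ℕ → ZMod 2) (t : ℕ) : Fin k → ZMod 2 := fun i => s (t + i)

theorem stateShift_seqWindow {m : ℕ} {g : (Fin m → ZMod 2) → ZMod 2} {s : ℕ → ZMod 2}
    (h : Generates (m + 1) g s) (t : ℕ) :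
    stateShift g (seqWindow (m + 1) s t) = seqWindow (m + 1) s (t + 1) := by
  ext i
  induction i using Fin.lastCases with
  | last =>
    rw [stateShift_last]
    have h1 := h t
    have h2 : Fin.tail (seqWindow (m + 1) s t) = fun i : Fin m => s (t + 1 + i) := by
      ext i
      simp only [Fin.tail, seqWindow, Fin.val_succ]
      congr 1; omega
    rw [h2]
    simp only [seqWindow, Fin.val_zero, add_zero, Fin.val_last]
    rw [show t + 1 + m = t + (m + 1) by omega]
    exact h1.symm
  | cast i =>
    rw [stateShift_castSucc]
    simp only [seqWindow, Fin.val_succ, Fin.val_castSucc]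
    congr 1; omega

theorem stateShift_pow_seqWindow {m : ℕ} {g : (Fin m → ZMod 2) → ZMod 2} {s : ℕ → ZMod 2}
    (h : Generates (m + 1) g s) (t : ℕ) :
    (stateShift g ^ t) (seqWindow (m + 1) s 0) = seqWindow (m + 1) s t := by
  induction t with
  | zero => rfl
  | succ t ih => rw [pow_succ', Equiv.Perm.mul_apply, ih, stateShift_seqWindow h]

theorem stateShift_pow_apply {m : ℕ} (g : (Fin m → ZMod 2) → ZMod 2) (x : Fin (m + 1) → ZMod 2)
    (i : Fin (m + 1)) (t : ℕ) : (stateShift g ^ t) x i = (stateShift g ^ (t + i)) x 0 := by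
  induction i using Fin.induction generalizing t with
  | zero => rfl
  | succ i ih =>
    rw [← stateShift_castSucc g ((stateShift g ^ t) x) i, ← Equiv.Perm.mul_apply, ← pow_succ', ih,
      Fin.val_castSucc, Fin.val_succ, show t + 1 + (i : ℕ) = t + (i + 1) by omega]

theorem generates_stateShift {m : ℕ} (g : (Fin m → ZMod 2) → ZMod 2)
    (x : Fin (m + 1) → ZMod 2) :
    Generates (m + 1) g (fun t => (stateShift g ^ t) x 0) := by
  intro t
  have h1 := stateShift_pow_apply g x (Fin.last m) (t + 1)
  rw [pow_succ', Equiv.Perm.mul_apply, stateShift_last] at h1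
  have h2 : Fin.tail ((stateShift g ^ t) x) =
      fun i : Fin m => (stateShift g ^ (t + 1 + i)) x 0 := by
    ext i
    simp only [Fin.tail]
    rw [stateShift_pow_apply, Fin.val_succ, show t + ((i : ℕ) + 1) = t + 1 + i by omega]
  rw [h2, Fin.val_last] at h1
  rw [show t + (m + 1) = t + 1 + m by omega]
  exact h1.symm

theorem card_fun_zmod_two (k : ℕ) : Fintype.card (Fin k → ZMod 2) = 2 ^ k := by
  simp

/-- The length `m + 1` windows of a generated sequence are the successive points of an orbit of the
state map, so meeting every window once means that one orbit fills the state space. -/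
theorem mem_deBruijnFunctions_iff {m : ℕ} (g : (Fin m → ZMod 2) → ZMod 2) :
    g ∈ deBruijnFunctions (m + 1) ↔ (stateShift g).IsCycleOn
      ((Finset.univ : Finset (Fin (m + 1) → ZMod 2)) : Set (Fin (m + 1) → ZMod 2)) := by
  constructor
  · rintro ⟨s, ⟨-, hs⟩, hg⟩
    refine ⟨by simp [Set.bijOn_univ], ?_⟩
    have key : ∀ x, (stateShift g).SameCycle (seqWindow (m + 1) s 0) x := by
      intro x
      obtain ⟨t, ⟨-, ht⟩, -⟩ := hs x
      refine ⟨t, ?_⟩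
      rw [zpow_natCast, stateShift_pow_seqWindow hg]
      exact funext ht
    exact fun x _ y _ => (key x).symm.trans (key y)
  · intro h
    refine ⟨fun t => (stateShift g ^ t) 0 0, ⟨fun t => ?_, fun w => ?_⟩,
      generates_stateShift g 0⟩
    · have := h.pow_card_apply (Finset.mem_univ 0)
      rw [Finset.card_univ, card_fun_zmod_two] at this
      beta_reduce
      rw [pow_add, Equiv.Perm.mul_apply, this]
    · obtain ⟨t, ht, hw⟩ := h.exists_pow_eq (Finset.mem_univ 0) (Finset.mem_univ w)
      rw [Finset.card_univ, card_fun_zmod_two] at ht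
      refine ⟨t, ⟨ht, fun i => ?_⟩, ?_⟩
      · beta_reduce
        rw [← stateShift_pow_apply, hw]
      · rintro t' ⟨ht', hw'⟩
        have h2 : (stateShift g ^ t') 0 = w := by
          ext i
          rw [stateShift_pow_apply]
          exact hw' i
        rw [← hw, h.pow_apply_eq_pow_apply (Finset.mem_univ _), Finset.card_univ,
          card_fun_zmod_two] at h2
        exact Nat.ModEq.eq_of_lt_of_lt h2 ht' ht

theorem det_one_sub_stateShift_add_ones {m : ℕ} (g : (Fin m → ZMod 2) → ZMod 2)
    [Decidable (g ∈ deBruijnFunctions (m + 1))] :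
    (Matrix.of fun i j => (if i = j then 1 else 0) - (if stateShift g i = j then 1 else 0) + 1 :
      Matrix _ _ ℝ).det = if g ∈ deBruijnFunctions (m + 1) then (2 ^ (m + 1) : ℝ) ^ 2 else 0 := by
  classical
  split_ifs with h
  · rw [mem_deBruijnFunctions_iff] at h
    have hne : ∀ x, stateShift g x ≠ x := fun x => h.apply_ne
      (by rw [Finset.coe_univ]; exact Set.nontrivial_univ)
      (Finset.mem_univ x)
    have hcyc : (stateShift g).IsCycle :=
      ⟨0, hne 0, fun y _ => h.2 (Finset.mem_univ _) (Finset.mem_univ y)⟩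
    have hs : (stateShift g).support = Finset.univ :=
      Finset.eq_univ_of_forall fun x => Equiv.Perm.mem_support.2 (hne x)
    rw [det_one_sub_cycle_add_ones _ hcyc hs, card_fun_zmod_two]
    simp
  · rw [mem_deBruijnFunctions_iff] at h
    obtain ⟨x, y, hxy⟩ : ∃ x y, ¬ (stateShift g).SameCycle x y := by
      by_contra! hall
      exact h ⟨by simp [Set.bijOn_univ], fun x _ y _ => hall x y⟩
    refine det_one_sub_perm_add_ones_eq_zero _
      (Finset.univ.filter fun z => (stateShift g).SameCycle x z) ⟨x, ?_⟩ ⟨y, ?_⟩ fun i => ?_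
    · simp [Equiv.Perm.SameCycle.refl]
    · simp [hxy]
    · simp [Equiv.Perm.sameCycle_apply_right]

/-- The first `Fintype.card V - 1` iterates of `x` are distinct and avoid the fixed point `z`, so by
counting they exhaust the other points. The bound on the cardinality makes `j = 1` admissible, so
that `x` is moved. -/
theorem Equiv.Perm.isCycle_of_pow_apply_ne {V : Type*} [Fintype V] [DecidableEq V]
    (σ : Equiv.Perm V) {z x : V} (hz : σ z = z) (hx : x ≠ z) (hV : 2 < Fintype.card V)
    (h : ∀ j, 0 < j → j < Fintype.card V - 1 → (σ ^ j) x ≠ x) :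
    σ.IsCycle ∧ σ.support = {z}ᶜ := by
  have hzp : ∀ j : ℕ, (σ ^ j) z = z := fun j =>
    Equiv.Perm.pow_apply_eq_self_of_apply_eq_self hz j
  have hlt : ∀ i j, i < j → j < Fintype.card V - 1 → (σ ^ i) x ≠ (σ ^ j) x := by
    intro i j hij hj he
    rw [show j = i + (j - i) by omega, pow_add, Equiv.Perm.mul_apply] at he
    exact h (j - i) (by omega) (by omega) ((σ ^ i).injective he).symm
  have himg : (Finset.range (Fintype.card V - 1)).image (fun j => (σ ^ j) x) = {z}ᶜ := by
    apply Finset.eq_of_subset_of_card_le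
    · intro y hy
      obtain ⟨j, -, rfl⟩ := Finset.mem_image.1 hy
      simp only [Finset.mem_compl, Finset.mem_singleton]
      intro he
      rw [← hzp j] at he
      exact hx ((σ ^ j).injective he)
    · rw [Finset.card_image_of_injOn, Finset.card_range, Finset.card_compl,
        Finset.card_singleton]
      intro i hi j hj he
      simp only [Finset.coe_range, Set.mem_Iio] at hi hj
      rcases lt_trichotomy i j with hij | hij | hij
      · exact absurd he (hlt i j hij hj)
      · exact hij
      · exact absurd he.symm (hlt j i hij hi)
  have hx1 : σ x ≠ x := by simpa using h 1 one_pos (by omega)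
  have horb : ∀ y, y ≠ z → ∃ j : ℕ, (σ ^ j) x = y := by
    intro y hy
    have : y ∈ ({z}ᶜ : Finset V) := by simpa using hy
    rw [← himg] at this
    obtain ⟨j, -, hj⟩ := Finset.mem_image.1 this
    exact ⟨j, hj⟩
  refine ⟨⟨x, hx1, fun y hy => ?_⟩, ?_⟩
  · obtain ⟨j, hj⟩ := horb y (fun he => hy (he ▸ hz))
    exact ⟨j, by rw [zpow_natCast, hj]⟩
  · ext y
    simp only [Equiv.Perm.mem_support, Finset.mem_compl, Finset.mem_singleton]
    refine ⟨fun hy he => hy (he ▸ hz), fun hy he => ?_⟩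
    obtain ⟨j, rfl⟩ := horb y hy
    rw [← Equiv.Perm.mul_apply, ← pow_succ', pow_succ, Equiv.Perm.mul_apply] at he
    exact hx1 ((σ ^ j).injective he)

/-! ### Characters of `ZMod 2 ^ k` -/

/-- The nontrivial sign character of `ZMod 2`. -/
def zmodSign (a : ZMod 2) : ℝ := if a = 0 then 1 else -1

theorem zmodSign_zero : zmodSign 0 = 1 := by simp [zmodSign]

theorem zmodSign_one : zmodSign 1 = -1 := by simp [zmodSign]

theorem zmodSign_add (a b : ZMod 2) : zmodSign (a + b) = zmodSign a * zmodSign b := by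
  have h : ∀ c : ZMod 2, c = 0 ∨ c = 1 := by decide
  rcases h a with rfl | rfl <;> rcases h b with rfl | rfl <;>
    simp [zmodSign_zero, zmodSign_one, CharTwo.add_self_eq_zero]

theorem sum_zmodSign_dotProduct {k : ℕ} (u : Fin k → ZMod 2) :
    ∑ x, zmodSign (u ⬝ᵥ x) = if u = 0 then (2 : ℝ) ^ k else 0 := by
  split_ifs with h
  · simp [h, zmodSign_zero]
  · obtain ⟨i, hi⟩ := Function.ne_iff.1 h
    have hi1 : u i = 1 := by
      have : ∀ c : ZMod 2, c ≠ 0 → c = 1 := by decide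
      exact this _ hi
    -- Translation by the basis vector at `i` negates every term because `u i = 1`, so the sum
    -- equals its own negative.
    have h1 := Equiv.sum_comp (Equiv.addRight (Pi.single i (1 : ZMod 2)))
      (fun x => zmodSign (u ⬝ᵥ x))
    simp only [Equiv.coe_addRight, dotProduct_add, zmodSign_add, dotProduct_single, hi1, mul_one,
      zmodSign_one, mul_neg, Finset.sum_neg_distrib] at h1
    linarith

/-- The Sylvester–Hadamard matrix, the character table of `ZMod 2 ^ k`. -/
def sylvesterMatrix (k : ℕ) : Matrix (Fin k → ZMod 2) (Fin k → ZMod 2) ℝ :=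
  Matrix.of fun x u => zmodSign (u ⬝ᵥ x)

theorem det_sylvesterMatrix_ne_zero (k : ℕ) : (sylvesterMatrix k).det ≠ 0 := by
  have h : sylvesterMatrix k * (sylvesterMatrix k).transpose = (2 : ℝ) ^ k • 1 := by
    ext x x'
    have h1 : x + x' = 0 ↔ x = x' := by
      rw [add_eq_zero_iff_eq_neg]
      have : -x' = x' := funext fun i => CharTwo.neg_eq _
      rw [this]
    simp only [Matrix.mul_apply, sylvesterMatrix, Matrix.transpose_apply, Matrix.of_apply,
      ← zmodSign_add, ← dotProduct_add, dotProduct_comm _ (x + x'), sum_zmodSign_dotProduct, h1,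
      Matrix.smul_apply, Matrix.one_apply, smul_eq_mul, mul_ite, mul_one, mul_zero]
  intro h0
  have h2 := congrArg Matrix.det h
  rw [Matrix.det_mul, h0, zero_mul, Matrix.det_smul, Matrix.det_one, mul_one] at h2
  exact absurd h2.symm (by positivity)

theorem prod_one_add_mul_zmodSign (m : ℕ) (y : ℝ) :
    ∏ v : Fin (m + 1) → ZMod 2, (1 + y * zmodSign (v (Fin.last m))) = (1 - y ^ 2) ^ 2 ^ m := by
  rw [← Equiv.prod_comp (Fin.snocEquiv fun _ => ZMod 2), Fintype.prod_prod_type]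
  have : (Finset.univ : Finset (ZMod 2)) = {0, 1} := rfl
  rw [this, Finset.prod_pair (by decide)]
  simp only [Fin.snocEquiv_apply, Fin.snoc_last, zmodSign_zero, zmodSign_one, Finset.prod_const,
    Finset.card_univ, card_fun_zmod_two, ← mul_pow]
  congr 1
  ring

/-! ### Linear registers, `m`-sequences and the dual cycle -/

/-- The state map of a linear shift register as a linear map. -/
def stateShiftLinear {m : ℕ} (l : (Fin m → ZMod 2) →ₗ[ZMod 2] ZMod 2) :
    (Fin (m + 1) → ZMod 2) →ₗ[ZMod 2] (Fin (m + 1) → ZMod 2) where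
  toFun := stateShift l
  map_add' x x' := by
    ext i
    induction i using Fin.lastCases with
    | last =>
      simp only [Pi.add_apply, stateShift_last]
      rw [show Fin.tail (x + x') = Fin.tail x + Fin.tail x' from rfl, map_add]
      ring
    | cast i => simp [stateShift_castSucc]
  map_smul' c x := by
    ext i
    induction i using Fin.lastCases with
    | last =>
      simp only [Pi.smul_apply, stateShift_last, RingHom.id_apply, smul_eq_mul]
      rw [show Fin.tail (c • x) = c • Fin.tail x from rfl, map_smul, smul_eq_mul]
      ring
    | cast i => simp [stateShift_castSucc]

/-- The least period bounds only the orbit of the given sequence, but that orbit already contains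
all nonzero states; every nonzero state therefore has the same return time. -/
theorem stateShift_pow_apply_ne {m : ℕ} (hm : 1 ≤ m) (l : (Fin m → ZMod 2) →ₗ[ZMod 2] ZMod 2)
    (hl : GeneratesMSequence (m + 1) l) (x : Fin (m + 1) → ZMod 2) (hx : x ≠ 0) (j : ℕ)
    (hj : 0 < j) (hj' : j < 2 ^ (m + 1) - 1) : (stateShift l ^ j) x ≠ x := by
  obtain ⟨s, hs, hp, hrun⟩ := hl
  have hw : seqWindow (m + 1) s 0 ≠ 0 := fun h0 => hrun ⟨0, fun i hi => congrFun h0 ⟨i, hi⟩⟩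
  have hne : ∀ j, 0 < j → j < 2 ^ (m + 1) - 1 →
      (stateShift l ^ j) (seqWindow (m + 1) s 0) ≠ seqWindow (m + 1) s 0 := by
    intro j hj hj' he
    refine absurd (hp.2 ⟨hj, fun t => ?_⟩) (not_le.2 hj')
    have h1 := stateShift_pow_seqWindow hs (t + j)
    rw [pow_add, Equiv.Perm.mul_apply, he, stateShift_pow_seqWindow hs] at h1
    exact (congrFun h1 0).symm
  have h4 : 2 ^ 2 ≤ 2 ^ (m + 1) := Nat.pow_le_pow_right (by norm_num) (by omega)
  obtain ⟨hcyc, hsupp⟩ := Equiv.Perm.isCycle_of_pow_apply_ne (stateShift l)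
    (map_zero (stateShiftLinear l)) hw (by rw [card_fun_zmod_two]; omega)
    (by rw [card_fun_zmod_two]; exact hne)
  have hmem : ∀ v, v ≠ 0 → stateShift l v ≠ v := by
    intro v hv
    rw [← Equiv.Perm.mem_support, hsupp]
    simpa using hv
  obtain ⟨i, rfl⟩ := hcyc.exists_pow_eq (hmem _ hw) (hmem x hx)
  rw [← Equiv.Perm.mul_apply, ← pow_add, add_comm j i, pow_add, Equiv.Perm.mul_apply]
  exact fun he => hne j hj hj' ((stateShift l ^ i).injective he)

/-- The transpose inherits the single cycle on nonzero vectors: for `0 < j < 2 ^ (m + 1) - 1` the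
map `A ^ j - 1` is injective, hence surjective, so a vector fixed by the `j`-th power of the
transpose is orthogonal to everything and vanishes. -/
theorem exists_dual_cycle {m : ℕ} (hm : 1 ≤ m) (l : (Fin m → ZMod 2) →ₗ[ZMod 2] ZMod 2)
    (hl : GeneratesMSequence (m + 1) l) :
    ∃ σ : Equiv.Perm (Fin (m + 1) → ZMod 2), σ.IsCycle ∧ σ.support = {0}ᶜ ∧ σ 0 = 0 ∧
      ∀ u x, u ⬝ᵥ stateShift l x = σ u ⬝ᵥ x := by
  let A := LinearMap.toMatrix' (stateShiftLinear l)
  have hA : ∀ x, A.mulVec x = stateShift l x := fun x =>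
    LinearMap.toMatrix'_mulVec (stateShiftLinear l) x
  have hdual : ∀ u x, u ⬝ᵥ stateShift l x = Matrix.vecMul u A ⬝ᵥ x := by
    intro u x
    rw [← hA, Matrix.dotProduct_mulVec]
  have hinj : Function.Injective fun u => Matrix.vecMul u A := by
    intro u u' h
    refine dotProduct_eq _ _ fun x => ?_
    obtain ⟨x, rfl⟩ := (stateShift l).surjective x
    rw [hdual, hdual]
    exact congrArg (· ⬝ᵥ x) h
  let σ := Equiv.ofBijective _ (Finite.injective_iff_bijective.1 hinj)
  have hσ : ∀ u x, u ⬝ᵥ stateShift l x = σ u ⬝ᵥ x := hdual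
  have h0 : σ 0 = 0 := Matrix.zero_vecMul A
  have hpow : ∀ (j : ℕ) u x, u ⬝ᵥ (stateShift l ^ j) x = (σ ^ j) u ⬝ᵥ x := by
    intro j
    induction j with
    | zero => exact fun _ _ => rfl
    | succ j ih =>
      intro u x
      rw [pow_succ, Equiv.Perm.mul_apply, ih, hσ, pow_succ', Equiv.Perm.mul_apply]
  have h4 : 2 ^ 2 ≤ 2 ^ (m + 1) := Nat.pow_le_pow_right (by norm_num) (by omega)
  have hne : (Pi.single 0 1 : Fin (m + 1) → ZMod 2) ≠ 0 := by simp
  obtain ⟨hc, hs⟩ := Equiv.Perm.isCycle_of_pow_apply_ne σ h0 hne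
    (by rw [card_fun_zmod_two]; omega) (by
      rw [card_fun_zmod_two]
      intro j hj hj' he
      let D := stateShiftLinear l ^ j - 1
      have hD : ∀ x, D x = (stateShift l ^ j) x - x := by
        intro x
        have : ∀ i : ℕ, (stateShiftLinear l ^ i) x = (stateShift l ^ i) x := by
          intro i
          induction i with
          | zero => rfl
          | succ i ih =>
            rw [pow_succ', pow_succ', Equiv.Perm.mul_apply, ← ih]; rfl
        simp [D, this]
      have hDinj : Function.Injective D := by
        rw [injective_iff_map_eq_zero]
        intro x hx
        by_contra hx0
        rw [hD, sub_eq_zero] at hx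
        exact stateShift_pow_apply_ne hm l hl x hx0 j hj hj' hx
      have hDsurj := Finite.surjective_of_injective hDinj
      apply hne
      refine dotProduct_eq _ _ fun x => ?_
      obtain ⟨x, rfl⟩ := hDsurj x
      rw [hD, dotProduct_sub, hpow, he, sub_self, zero_dotProduct])
  exact ⟨σ, hc, hs, h0, hσ⟩

/-! ### The weighted determinant in the character basis -/

theorem det_weighted_stateShift {m : ℕ} (hm : 1 ≤ m)
    (l : (Fin m → ZMod 2) →ₗ[ZMod 2] ZMod 2) (hl : GeneratesMSequence (m + 1) l) (y : ℝ) :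
    (Matrix.of fun x z : Fin (m + 1) → ZMod 2 => (1 + y) * ((if x = z then 1 else 0) + 1) -
      (if stateShift l x = z then 1 else 0) -
      y * (if stateShift l x + Pi.single (Fin.last m) 1 = z then 1 else 0) :
      Matrix _ _ ℝ).det =
    2 ^ (m + 1) * ((1 + y) ^ 2 ^ (m + 1) - (1 - y ^ 2) ^ 2 ^ m) := by
  obtain ⟨σ, hc, hs, h0, hσ⟩ := exists_dual_cycle hm l hl
  set K : Matrix (Fin (m + 1) → ZMod 2) (Fin (m + 1) → ZMod 2) ℝ :=
    Matrix.of fun x z : Fin (m + 1) → ZMod 2 => (1 + y) * ((if x = z then 1 else 0) + 1) -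
      (if stateShift l x = z then 1 else 0) -
      y * (if stateShift l x + Pi.single (Fin.last m) 1 = z then 1 else 0) with hK
  -- At `v = 0` the all-ones part adds `(1 + y) * 2 ^ (m + 1)`, while the term `-w 0 = -(1 + y)` of
  -- the fixed point `σ 0 = 0` cancels the `1 + y` coming from the identity.
  let d : (Fin (m + 1) → ZMod 2) → ℝ := fun v => (1 + y) * (if v = 0 then 2 ^ (m + 1) else 1)
  -- Flipping the last bit of the successor multiplies the character `v` by `zmodSign (v (Fin.last
  -- m))`.
  let w : (Fin (m + 1) → ZMod 2) → ℝ := fun v => 1 + y * zmodSign (v (Fin.last m))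
  let L : Matrix (Fin (m + 1) → ZMod 2) (Fin (m + 1) → ZMod 2) ℝ :=
    Matrix.of fun i j => if i = j then d j else if i = σ j then -w j else 0
  have hconj : K * sylvesterMatrix (m + 1) = sylvesterMatrix (m + 1) * L := by
    ext x v
    have hl1 : (K * sylvesterMatrix (m + 1)) x v = (1 + y) * zmodSign (v ⬝ᵥ x) +
        (1 + y) * (if v = 0 then 2 ^ (m + 1) else 0) - w v * zmodSign (σ v ⬝ᵥ x) := by
      have hterm : ∀ z, K x z * sylvesterMatrix (m + 1) z v =
          (1 + y) * (if x = z then zmodSign (v ⬝ᵥ z) else 0) + (1 + y) * zmodSign (v ⬝ᵥ z) -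
          (if stateShift l x = z then zmodSign (v ⬝ᵥ z) else 0) -
          y * (if stateShift l x + Pi.single (Fin.last m) 1 = z then zmodSign (v ⬝ᵥ z)
            else 0) := by
        intro z
        simp only [hK, sylvesterMatrix, Matrix.of_apply, sub_mul, mul_assoc, add_mul, ite_mul,
          one_mul, zero_mul, mul_add]
      rw [Matrix.mul_apply, Finset.sum_congr rfl fun z _ => hterm z, Finset.sum_sub_distrib,
        Finset.sum_sub_distrib, Finset.sum_add_distrib, ← Finset.mul_sum, ← Finset.mul_sum,
        ← Finset.mul_sum, sum_zmodSign_dotProduct]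
      simp only [Finset.sum_ite_eq, Finset.mem_univ, if_true, dotProduct_add, zmodSign_add, hσ,
        dotProduct_single, mul_one, w]
      ring
    rw [hl1, Matrix.mul_apply]
    by_cases hv : v = 0
    · subst hv
      rw [Finset.sum_eq_single 0]
      · simp [L, sylvesterMatrix, h0, d, w, zmodSign_zero]
      · intro u _ hu
        simp [L, h0, hu]
      · exact fun h => absurd (Finset.mem_univ _) h
    · have hσv : σ v ≠ v := by
        rw [← Equiv.Perm.mem_support, hs]; simpa using hv
      have hterm : ∀ u, sylvesterMatrix (m + 1) x u * L u v =
          (if u = v then zmodSign (u ⬝ᵥ x) * (1 + y) else 0) -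
          (if u = σ v then zmodSign (u ⬝ᵥ x) * w v else 0) := by
        intro u
        simp only [sylvesterMatrix, L, Matrix.of_apply, d, hv, if_false, mul_one]
        by_cases h1 : u = v
        · simp [h1, hσv.symm]
        · by_cases h2 : u = σ v <;> simp [h1, h2, hσv]
      rw [Finset.sum_congr rfl fun u _ => hterm u, Finset.sum_sub_distrib]
      simp only [hv, if_false, Finset.sum_ite_eq', Finset.mem_univ, if_true]
      ring
  have hdet := congrArg Matrix.det hconj
  rw [Matrix.det_mul, Matrix.det_mul, mul_comm] at hdet
  rw [mul_left_cancel₀ (det_sylvesterMatrix_ne_zero _) hdet,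
    Matrix.det_diagonal_sub_cycle σ hc d w, hs, compl_compl, Finset.prod_singleton]
  have hd : ∏ v, d v = 2 ^ (m + 1) * (1 + y) ^ 2 ^ (m + 1) := by
    simp only [d, Finset.prod_mul_distrib, Finset.prod_const, Finset.card_univ,
      card_fun_zmod_two, Finset.prod_ite_eq', Finset.mem_univ, if_true]
    ring
  -- This supplies the factor `w 0` missing from the product over the cycle, which then runs over
  -- all vectors.
  have hd0 : d 0 = 2 ^ (m + 1) * w 0 := by
    simp [d, w, zmodSign_zero]; ring
  have hw := prod_one_add_mul_zmodSign m y
  rw [← Finset.prod_mul_prod_compl {0}, Finset.prod_singleton] at hw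
  rw [hd, hd0, ← hw]
  simp only [w]
  ring

/-! ### The generating function as one determinant -/

theorem stateShift_add_cons {m : ℕ} (f e : (Fin m → ZMod 2) → ZMod 2) (a : ZMod 2)
    (d : Fin m → ZMod 2) :
    stateShift (f + e) (Fin.cons (α := fun _ => ZMod 2) a d) =
      stateShift f (Fin.cons (α := fun _ => ZMod 2) a d) + Pi.single (Fin.last m) (e d) := by
  ext i
  induction i using Fin.lastCases with
  | last => simp [stateShift_last, add_assoc]
  | cast i => simp [stateShift_castSucc]

theorem stateShift_cons {m : ℕ} (f : (Fin m → ZMod 2) → ZMod 2) (a b : ZMod 2)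
    (d : Fin m → ZMod 2) :
    stateShift f (Fin.cons (α := fun _ => ZMod 2) (a + b) d) =
      stateShift f (Fin.cons (α := fun _ => ZMod 2) a d) + Pi.single (Fin.last m) b := by
  ext i
  induction i using Fin.lastCases with
  | last => simp [stateShift_last]; ring
  | cast i => simp [stateShift_castSucc]

/-- States of a shift register, split according to the value of the first bit. -/
def sumEquivState (m : ℕ) :
    (Fin m → ZMod 2) ⊕ (Fin m → ZMod 2) ≃ (Fin (m + 1) → ZMod 2) where
  toFun := Sum.elim (Fin.cons (α := fun _ => ZMod 2) 0) (Fin.cons (α := fun _ => ZMod 2) 1)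
  invFun x := if x 0 = 0 then Sum.inl (Fin.tail x) else Sum.inr (Fin.tail x)
  left_inv s := by rcases s with d | d <;> simp
  right_inv x := by
    have h : ∀ c : ZMod 2, c = 0 ∨ c = 1 := by decide
    rcases h (x 0) with h0 | h0
    · simp only [h0, if_true, Sum.elim_inl]
      rw [← h0, Fin.cons_self_tail]
    · simp only [h0, one_ne_zero, if_false, Sum.elim_inr]
      rw [← h0, Fin.cons_self_tail]

theorem prod_ite_eq_pow_hammingNorm {ι : Type*} [Fintype ι] (e : ι → ZMod 2) (y : ℝ) :
    ∏ d, (if e d = 0 then 1 else y) = y ^ hammingNorm e := by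
  rw [hammingNorm, Finset.prod_ite]
  simp

theorem sum_det_stateShift {m : ℕ} (f : (Fin m → ZMod 2) → ZMod 2) (y : ℝ) :
    (1 + y) ^ 2 ^ m * ∑ g : (Fin m → ZMod 2) → ZMod 2, y ^ hammingNorm (f + g) *
      (Matrix.of fun i j => (if i = j then 1 else 0) - (if stateShift g i = j then 1 else 0) + 1 :
        Matrix _ _ ℝ).det =
    (Matrix.of fun x z : Fin (m + 1) → ZMod 2 => (1 + y) * ((if x = z then 1 else 0) + 1) -
      (if stateShift f x = z then 1 else 0) -
      y * (if stateShift f x + Pi.single (Fin.last m) 1 = z then 1 else 0) :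
      Matrix _ _ ℝ).det := by
  let E := sumEquivState m
  -- `row a d e` is the row of the state `(a, d)` when the feedback value at `d` is changed by `e`.
  let row : ZMod 2 → (Fin m → ZMod 2) → ZMod 2 → (Fin m → ZMod 2) ⊕ (Fin m → ZMod 2) → ℝ :=
    fun a d e j => (if Fin.cons (α := fun _ => ZMod 2) a d = E j then 1 else 0) -
      (if stateShift f (Fin.cons (α := fun _ => ZMod 2) a d) + Pi.single (Fin.last m) e = E j
        then 1 else 0) + 1
  -- Toggling the feedback at `d` swaps the successors of `(0, d)` and `(1, d)`, which leaves the
  -- sum of the two rows unchanged.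
  have hS : ∀ d e, row 0 d e + row 1 d e = row 0 d 0 + row 1 d 0 := by
    intro d e
    have h : ∀ c : ZMod 2, c = 0 ∨ c = 1 := by decide
    rcases h e with rfl | rfl
    · rfl
    · ext j
      have h1 := stateShift_cons f 0 1 d
      rw [zero_add] at h1
      simp only [Pi.add_apply, row, h1, add_assoc, CharTwo.add_self_eq_zero, Pi.single_zero, add_zero]
      ring
  have key := sum_det_sumElim (row 0) (row 1) _ hS y
  rw [card_fun_zmod_two] at key
  -- The sum is reindexed by `g = f + e`, so that the exponent becomes the weight of `e`.
  rw [← Equiv.sum_comp (Equiv.addLeft f), ← Matrix.det_submatrix_equiv_self E (Matrix.of _)]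
  convert key using 1
  · congr 1
    refine Finset.sum_congr rfl fun e _ => ?_
    have he : f + (Equiv.addLeft f) e = e := by
      ext d
      simp [← add_assoc, CharTwo.add_self_eq_zero]
    rw [he, ← prod_ite_eq_pow_hammingNorm, ← Matrix.det_submatrix_equiv_self E]
    congr 2
    ext i j
    rcases i with d | d <;>
      simp [E, sumEquivState, row, stateShift_add_cons]
  · congr 1
    ext i j
    rcases i with d | d <;>
      simp [E, sumEquivState, row, -mul_ite] <;> ring

theorem deBruijnGenFun_eq_sum {m : ℕ} (f : (Fin m → ZMod 2) → ZMod 2) (y : ℝ)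
    [DecidablePred (· ∈ deBruijnFunctions (m + 1))] :
    deBruijnGenFun (m + 1) f y = ∑ g : (Fin m → ZMod 2) → ZMod 2, y ^ hammingNorm (f + g) *
      (if g ∈ deBruijnFunctions (m + 1) then 1 else 0) := by
  have hcount : ∀ k, (deBruijnCount (m + 1) f k : ℝ) =
      ∑ g : (Fin m → ZMod 2) → ZMod 2 with hammingNorm (f + g) = k,
        (if g ∈ deBruijnFunctions (m + 1) then (1 : ℝ) else 0) := by
    intro k
    rw [Finset.sum_boole, Finset.filter_filter, deBruijnCount, ← Set.ncard_coe_finset]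
    congr 2
    ext g
    simp [deBruijnAtDistance, and_comm]
  rw [deBruijnGenFun, ← Finset.sum_fiberwise_of_maps_to (s := Finset.univ)
    (t := Finset.range (2 ^ m + 1))
    (g := fun g : (Fin m → ZMod 2) → ZMod 2 => hammingNorm (f + g))]
  · refine Finset.sum_congr rfl fun k _ => ?_
    rw [hcount, Finset.sum_mul]
    refine Finset.sum_congr rfl fun g hg => ?_
    rw [← (Finset.mem_filter.1 hg).2, mul_comm]
  · intro g _
    rw [Finset.mem_range, Nat.lt_succ_iff, ← card_fun_zmod_two m]
    exact hammingNorm_le_card_fintype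

theorem one_add_pow_mul_deBruijnGenFun {m : ℕ} (hm : 1 ≤ m)
    (l : (Fin m → ZMod 2) →ₗ[ZMod 2] ZMod 2) (hl : GeneratesMSequence (m + 1) l) (y : ℝ) :
    (1 + y) ^ 2 ^ m * deBruijnGenFun (m + 1) l y =
      (1 + y) ^ 2 ^ m * (1 / 2 ^ (m + 1) * ((1 + y) ^ 2 ^ m - (1 - y) ^ 2 ^ m)) := by
  classical
  have h1 := sum_det_stateShift l y
  rw [det_weighted_stateShift hm l hl] at h1
  simp_rw [det_one_sub_stateShift_add_ones] at h1
  have h2 : ∑ g : (Fin m → ZMod 2) → ZMod 2, y ^ hammingNorm (⇑l + g) *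
      (if g ∈ deBruijnFunctions (m + 1) then (2 ^ (m + 1) : ℝ) ^ 2 else 0) =
      deBruijnGenFun (m + 1) l y * (2 ^ (m + 1) : ℝ) ^ 2 := by
    rw [deBruijnGenFun_eq_sum, Finset.sum_mul]
    refine Finset.sum_congr rfl fun g _ => ?_
    split_ifs <;> ring
  have h3 : (1 + y) ^ 2 ^ (m + 1) = (1 + y) ^ 2 ^ m * (1 + y) ^ 2 ^ m := by
    rw [← pow_add]; congr 1; ring
  rw [h2, h3, show 1 - y ^ 2 = (1 + y) * (1 - y) by ring, mul_pow, ← mul_sub] at h1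
  have h4 : (2 : ℝ) ^ (m + 1) ≠ 0 := by positivity
  field_simp
  apply mul_left_cancel₀ h4
  linear_combination h1

theorem deBruijnCount_eq_zero_of_lt {m : ℕ} (f : (Fin m → ZMod 2) → ZMod 2) {k : ℕ}
    (hk : 2 ^ m < k) : deBruijnCount (m + 1) f k = 0 := by
  rw [deBruijnCount, Set.ncard_eq_zero]
  refine Set.eq_empty_of_forall_notMem fun (g : (Fin m → ZMod 2) → ZMod 2) hg => ?_
  have h := hammingNorm_le_card_fintype (x := f + g)
  have h2 : hammingNorm (f + g) = k := hg.2
  rw [h2, card_fun_zmod_two] at h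
  omega

/-! ### Coefficients of the generating function -/

open Polynomial in
/-- The polynomial whose value at `y` is `deBruijnGenFun n f y`. -/
noncomputable def deBruijnGenPoly (n : ℕ) (f : (Fin (n - 1) → ZMod 2) → ZMod 2) : ℝ[X] :=
  ∑ k ∈ Finset.range (2 ^ (n - 1) + 1), C (deBruijnCount n f k : ℝ) * X ^ k

theorem eval_deBruijnGenPoly (n : ℕ) (f : (Fin (n - 1) → ZMod 2) → ZMod 2) (y : ℝ) :
    (deBruijnGenPoly n f).eval y = deBruijnGenFun n f y := by
  simp [deBruijnGenPoly, deBruijnGenFun, Polynomial.eval_finsetSum]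

theorem coeff_deBruijnGenPoly {m : ℕ} (f : (Fin m → ZMod 2) → ZMod 2) (k : ℕ) :
    (deBruijnGenPoly (m + 1) f).coeff k = deBruijnCount (m + 1) f k := by
  simp only [deBruijnGenPoly, Polynomial.finsetSum_coeff, Polynomial.coeff_C_mul,
    Polynomial.coeff_X_pow, mul_ite, mul_one, mul_zero, Finset.sum_ite_eq, Finset.mem_range]
  split_ifs with h
  · rfl
  · rw [deBruijnCount_eq_zero_of_lt f (by simpa using h), Nat.cast_zero]

open Polynomial in
-- The factor `(1 + y) ^ 2 ^ m` vanishes at `y = -1`, so it is cancelled between polynomials and not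
-- pointwise. The form `C (-1) * X` lets the coefficients be read off from a composition.
theorem deBruijnGenPoly_eq {m : ℕ} (hm : 1 ≤ m)
    (l : (Fin m → ZMod 2) →ₗ[ZMod 2] ZMod 2) (hl : GeneratesMSequence (m + 1) l) :
    deBruijnGenPoly (m + 1) l =
      C (1 / 2 ^ (m + 1) : ℝ) * ((1 + X) ^ 2 ^ m - (1 + C (-1) * X) ^ 2 ^ m) := by
  have hne : ((1 + X : ℝ[X]) ^ 2 ^ m) ≠ 0 := by
    apply pow_ne_zero
    intro h
    have := congrArg (eval 0) h
    simp at this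
  apply mul_left_cancel₀ hne
  refine Polynomial.funext fun y => ?_
  have := one_add_pow_mul_deBruijnGenFun hm l hl y
  simp only [eval_mul, eval_pow, eval_add, eval_one, eval_X, eval_deBruijnGenPoly, eval_C,
    eval_sub]
  rw [this]
  ring

open Polynomial in
theorem deBruijnCount_eq_choose {m : ℕ} (hm : 1 ≤ m)
    (l : (Fin m → ZMod 2) →ₗ[ZMod 2] ZMod 2) (hl : GeneratesMSequence (m + 1) l) (k : ℕ) :
    (deBruijnCount (m + 1) l k : ℝ) =
      1 / 2 ^ (m + 1) * ((2 ^ m).choose k * (1 - (-1) ^ k)) := by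
  have h : ((1 + C (-1) * X : ℝ[X]) ^ 2 ^ m).coeff k = (2 ^ m).choose k * (-1) ^ k := by
    have : (1 + C (-1) * X : ℝ[X]) ^ 2 ^ m = ((1 + X) ^ 2 ^ m).comp (C (-1) * X) := by simp
    rw [this, comp_C_mul_X_coeff, coeff_one_add_X_pow]
  rw [← coeff_deBruijnGenPoly, deBruijnGenPoly_eq hm l hl, coeff_C_mul, coeff_sub, h,
    coeff_one_add_X_pow]
  ring

theorem deBruijnCount_of_odd {m : ℕ} (hm : 1 ≤ m)
    (l : (Fin m → ZMod 2) →ₗ[ZMod 2] ZMod 2) (hl : GeneratesMSequence (m + 1) l) {k : ℕ}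
    (hk : Odd k) : (deBruijnCount (m + 1) l k : ℝ) =
      (∏ j ∈ Finset.Icc 1 (k - 1), ((2 : ℝ) ^ m - j)) / k.factorial := by
  obtain ⟨i, rfl⟩ := hk
  have h1 : (((2 ^ m).descFactorial (2 * i + 1) : ℕ) : ℝ) =
      (2 * i + 1).factorial * (2 ^ m).choose (2 * i + 1) := by
    exact_mod_cast Nat.descFactorial_eq_factorial_mul_choose _ _
  have h2 : ∀ a k : ℕ, (((a + 1).descFactorial (k + 1) : ℕ) : ℝ) =
      (a + 1 : ℕ) * ∏ j ∈ Finset.Icc 1 k, (((a + 1 : ℕ) : ℝ) - j) := by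
    intro a k
    induction k with
    | zero => simp
    | succ k ih =>
      rw [Nat.descFactorial_succ, Nat.cast_mul, ih, Finset.prod_Icc_succ_top (by omega)]
      rcases le_or_gt (k + 1) (a + 1) with h | h
      · rw [Nat.cast_sub h]; ring
      -- Beyond `a + 1` the natural subtraction truncates, but the product already contains the zero
      -- factor `j = a + 1`.
      · have : ∏ j ∈ Finset.Icc 1 k, (((a + 1 : ℕ) : ℝ) - j) = 0 :=
          Finset.prod_eq_zero (i := a + 1) (Finset.mem_Icc.2 ⟨by omega, by omega⟩) (sub_self _)
        rw [this]; ring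
  obtain ⟨a, ha⟩ : ∃ a, 2 ^ m = a + 1 := ⟨2 ^ m - 1, (Nat.sub_add_cancel Nat.one_le_two_pow).symm⟩
  have h3 := h2 a (2 * i)
  rw [← ha, h1] at h3
  push_cast at h3
  rw [deBruijnCount_eq_choose hm l hl, Odd.neg_one_pow ⟨i, rfl⟩, Nat.add_sub_cancel]
  have h4 : ((2 * i + 1).factorial : ℝ) ≠ 0 := by positivity
  rw [eq_div_iff h4, pow_succ]
  field_simp
  linear_combination 2 * h3

theorem Polynomial.iteratedDeriv_eval_zero (p : Polynomial ℝ) (k : ℕ) :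
    iteratedDeriv k (fun y => p.eval y) 0 = k.factorial * p.coeff k := by
  have h : ∀ k, iteratedDeriv k (fun y => p.eval y) =
      fun y => (Polynomial.derivative^[k] p).eval y := by
    intro k
    induction k with
    | zero => simp
    | succ k ih =>
      rw [iteratedDeriv_succ, ih]
      ext y
      rw [Polynomial.deriv, Function.iterate_succ_apply']
  rw [h]
  beta_reduce
  rw [← Polynomial.coeff_zero_eq_eval_zero, Polynomial.coeff_iterate_derivative, zero_add,
    Nat.descFactorial_self, nsmul_eq_mul]

/-! ### The closed form and its consequences -/

theorem mainTheorem1 (n : ℕ) (hn : 2 ≤ n)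
    (l : (Fin (n - 1) → ZMod 2) →ₗ[ZMod 2] ZMod 2) (hl : GeneratesMSequence n l) :
    (∀ y : ℝ, deBruijnGenFun n l y =
      1 / 2 ^ n * ((1 + y) ^ 2 ^ (n - 1) - (1 - y) ^ 2 ^ (n - 1))) ∧
    (∀ k : ℕ, (deBruijnCount n l k : ℝ) =
      1 / (k.factorial : ℝ) * iteratedDeriv k (deBruijnGenFun n l) 0) ∧
    deBruijnCount n l 1 = 1 ∧
    (∀ k : ℕ, Even k → deBruijnCount n l k = 0) ∧
    (deBruijnCount n l 3 : ℝ) =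
      ((2 : ℝ) ^ (n - 1) - 1) * ((2 : ℝ) ^ (n - 1) - 2) / (Nat.factorial 3 : ℝ) ∧
    (deBruijnCount n l 5 : ℝ) =
      ((2 : ℝ) ^ (n - 1) - 1) * ((2 : ℝ) ^ (n - 1) - 2) * ((2 : ℝ) ^ (n - 1) - 3) *
        ((2 : ℝ) ^ (n - 1) - 4) / (Nat.factorial 5 : ℝ) ∧
    (∀ k : ℕ, Odd k → k ≤ 2 ^ (n - 1) - 1 →
      (deBruijnCount n l k : ℝ) =
        (∏ j ∈ Finset.Icc 1 (k - 1), ((2 : ℝ) ^ (n - 1) - (j : ℝ))) / (k.factorial : ℝ)) ∧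
    deBruijnCount n l (2 ^ (n - 1) - 1) = 1 ∧
    (∀ k : ℕ, 2 ^ (n - 1) - 1 < k → deBruijnCount n l k = 0) ∧
    deBruijnGenFun n l 1 = ((∑ k ∈ Finset.Icc 1 (2 ^ (n - 1) - 1), deBruijnCount n l k : ℕ) : ℝ) ∧
    ∑ k ∈ Finset.Icc 1 (2 ^ (n - 1) - 1), deBruijnCount n l k = 2 ^ (2 ^ (n - 1) - n) := by
  obtain ⟨m, rfl⟩ : ∃ m, n = m + 1 := ⟨n - 1, by omega⟩
  have hm : 1 ≤ m := by omega
  simp only [Nat.add_sub_cancel] at l hl ⊢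
  have hfun : deBruijnGenFun (m + 1) l = fun y => (deBruijnGenPoly (m + 1) l).eval y :=
    funext fun y => (eval_deBruijnGenPoly _ _ y).symm
  have hG : ∀ y : ℝ, deBruijnGenFun (m + 1) l y =
      1 / 2 ^ (m + 1) * ((1 + y) ^ 2 ^ m - (1 - y) ^ 2 ^ m) := by
    intro y
    rw [← eval_deBruijnGenPoly, deBruijnGenPoly_eq hm l hl]
    simp [sub_eq_add_neg]
  have hodd : ∀ k : ℕ, Odd k → (deBruijnCount (m + 1) l k : ℝ) =
      (∏ j ∈ Finset.Icc 1 (k - 1), ((2 : ℝ) ^ m - j)) / k.factorial :=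
    fun k hk => deBruijnCount_of_odd hm l hl hk
  have heven : ∀ k : ℕ, Even k → deBruijnCount (m + 1) l k = 0 := by
    intro k hk
    have h := deBruijnCount_eq_choose hm l hl k
    rw [hk.neg_one_pow, sub_self, mul_zero, mul_zero] at h
    exact_mod_cast h
  have hMeven : Even (2 ^ m) := (Nat.even_pow' (by omega)).2 even_two
  have hMpos : 2 ≤ 2 ^ m := by simpa using Nat.pow_le_pow_right (n := 2) (by norm_num) hm
  have hlarge : ∀ k : ℕ, 2 ^ m - 1 < k → deBruijnCount (m + 1) l k = 0 := by
    intro k hk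
    -- The boundary case `k = 2 ^ m` is excluded by parity, the larger ones by the size of the truth
    -- table.
    rcases (show 2 ^ m ≤ k by omega).eq_or_lt with rfl | h
    · exact heven _ hMeven
    · exact deBruijnCount_eq_zero_of_lt _ h
  have hG1 : deBruijnGenFun (m + 1) l 1 =
      ((∑ k ∈ Finset.Icc 1 (2 ^ m - 1), deBruijnCount (m + 1) l k : ℕ) : ℝ) := by
    simp only [deBruijnGenFun, one_pow, mul_one]
    rw [Nat.cast_sum]
    symm
    apply Finset.sum_subset
    · intro k hk
      simp only [Finset.mem_Icc, Finset.mem_range, Nat.add_sub_cancel] at hk ⊢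
      omega
    · intro k _ hk
      simp only [Finset.mem_Icc, not_and_or, not_le] at hk
      rcases hk with hk | hk
      · rw [Nat.lt_one_iff.1 hk, heven 0 Even.zero, Nat.cast_zero]
      · rw [hlarge k hk, Nat.cast_zero]
  refine ⟨hG, fun k => ?_, ?_, heven, ?_, ?_, fun k hk _ => hodd k hk, ?_, hlarge, hG1, ?_⟩
  · rw [hfun, Polynomial.iteratedDeriv_eval_zero, coeff_deBruijnGenPoly]
    have : (k.factorial : ℝ) ≠ 0 := by positivity
    field_simp
  · have h := hodd 1 odd_one
    simp only [Nat.sub_self, Nat.factorial_one, Nat.cast_one, div_one] at h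
    simpa using h
  · rw [hodd 3 (by decide)]
    simp [Finset.prod_Icc_succ_top]
  · rw [hodd 5 (by decide)]
    simp [Finset.prod_Icc_succ_top]
  · have h := deBruijnCount_eq_choose hm l hl (2 ^ m - 1)
    have ho : Odd (2 ^ m - 1) := Nat.Even.sub_odd (by omega) hMeven odd_one
    rw [ho.neg_one_pow, Nat.choose_symm (by omega : 1 ≤ 2 ^ m), Nat.choose_one_right, pow_succ]
      at h
    push_cast at h
    have h2 : (2 : ℝ) ^ m ≠ 0 := by positivity
    field_simp at h
    have h3 : (deBruijnCount (m + 1) l (2 ^ m - 1) : ℝ) = 1 := by linarith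
    exact_mod_cast h3
  -- This keeps the exponent `2 ^ m - (m + 1)` from truncating.
  · have hle : m + 1 ≤ 2 ^ m := Nat.lt_two_pow_self
    have h := hG 1
    have h0 : (1 - 1 : ℝ) ^ 2 ^ m = 0 := by rw [sub_self, zero_pow (by omega)]
    have h2 : (2 : ℝ) ^ 2 ^ m = 2 ^ (2 ^ m - (m + 1)) * 2 ^ (m + 1) := by
      rw [← pow_add, Nat.sub_add_cancel hle]
    rw [hG1, h0, sub_zero, one_add_one_eq_two, h2] at h
    have h4 : (2 : ℝ) ^ (m + 1) ≠ 0 := by positivity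
    field_simp at h
    exact_mod_cast h
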